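/- A mean on a set $X$ is a finitely additive probability measure $m$ defined on all subsets of $X$; it is atomless if $m(\{x\})=0$ for all $x\in X$, and it concentrates on $S\subseteq X$ if $m(S)=1$. A mean $m$ on a group $G$ is conjugation invariant if $m(gEg^{-1})=m(E)$ for all $g\in G$ and $E\subseteq G$. A (discrete) group is inner amenable if it admits an atomless conjugation invariant mean. (a) Let $G=A*_H B$ be an amalgamated free product of groups over a common subgroup $H$ which is nondegenerate, i.e. $H\neq A$, $H\neq B$, and the (possibly infinite) index of $H$ in at least one of $A$, $B$ is at least three. Then: (1) every conjugation invariant mean on $G$ concentrates on $H$; (2) $G$ is inner amenable if and only if there exist conjugation invariant, atomless means $m_A$ on $A$ and $m_B$ on $B$ with $m_A(H)=m_B(H)=1$ and $m_A(E)=m_B(E)$ for every $E\subseteq H$; (3) if $G$ is inner amenable, then so are $A$, $B$ and $H$. (b) Let $K$ be a group, $H\leq K$ a subgroup, $\varphi:H\to K$ an injective homomorphism, and let $G=\mathrm{HNN}(K,H,\varphi)=\langle K,t\mid tht^{-1}=\varphi(h)\ (h\in H)\rangle$. Suppose that $G$ is non-ascending, i.e. $H\neq K$ and $\varphi(H)\neq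 K$. Then: (1) every conjugation invariant mean on $G$ concentrates on $H$; (2) $G$ is inner amenable if and only if there exists a conjugation invariant, atomless mean $m$ on $K$ with $m(H)=1$ and $m(E)=m(\varphi(E))$ for every $E\subseteq H$; (3) if $G$ is inner amenable, then so are $K$ and $H$. -/

import Mathlib

universe u v w

/-- A mean on a set `X`: a finitely additive probability measure defined on all subsets of `X`. -/
structure Mean (X : Type*) where
  toFun : Set X → ℝ
  nonneg' : ∀ E, 0 ≤ toFun E
  univ' : toFun Set.univ = 1
  union' : ∀ E F, Disjoint E F → toFun (E ∪ F) = toFun E + toFun F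

namespace Mean

instance {X : Type*} : CoeFun (Mean X) (fun _ => Set X → ℝ) := ⟨Mean.toFun⟩

/-- A mean is atomless if every point has measure zero. -/
def Atomless {X : Type*} (m : Mean X) : Prop := ∀ x : X, m {x} = 0

/-- A mean concentrates on a set if that set has full measure. -/
def ConcentratesOn {X : Type*} (m : Mean X) (S : Set X) : Prop := m S = 1

/-- Invariance under the action of `G` on itself by conjugation. -/
def ConjInvariant {G : Type*} [Group G] (m : Mean G) : Prop :=
  ∀ (g : G) (E : Set G), m ((fun x => g * x * g⁻¹) '' E) = m E

end Mean

/-- A (discrete) group is inner amenable if it carries an atomless conjugation invariant mean. -/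
def InnerAmenable (G : Type*) [Group G] : Prop :=
  ∃ m : Mean G, m.ConjInvariant ∧ m.Atomless

namespace Amalgam

/-- The two-element family `A, B`. -/
def Factor (A B : Type u) : Bool → Type u
  | false => A
  | true => B

instance instGroupFactor (A B : Type u) [Group A] [Group B] : ∀ b, Group (Factor A B b)
  | false => inferInstanceAs (Group A)
  | true => inferInstanceAs (Group B)

/-- The two homomorphisms out of `H`, as a family. -/
def incl {A B : Type u} {H : Type v} [Group A] [Group B] [Group H]
    (iA : H →* A) (iB : H →* B) : ∀ b, H →* Factor A B b
  | false => iA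
  | true => iB

end Amalgam

/-- The amalgamated free product `A *_H B` along homomorphisms `iA : H →* A` and `iB : H →* B`
(injective in all uses). The canonical image of `H` is the range of
`Monoid.PushoutI.base (Amalgam.incl iA iB)`. -/
abbrev AmalgamatedProduct {A B : Type u} {H : Type v} [Group A] [Group B] [Group H]
    (iA : H →* A) (iB : H →* B) : Type _ :=
  Monoid.PushoutI (Amalgam.incl iA iB)

/-- Nondegeneracy of an amalgam: `H ≠ A`, `H ≠ B`, and the (possibly infinite) index of `H` in
`A` or in `B` is at least three. -/
def NondegenerateAmalgam {A B : Type u} {H : Type v} [Group A] [Group B] [Group H]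
    (iA : H →* A) (iB : H →* B) : Prop :=
  iA.range ≠ ⊤ ∧ iB.range ≠ ⊤ ∧
    (3 ≤ ENat.card (A ⧸ iA.range) ∨ 3 ≤ ENat.card (B ⧸ iB.range))

/-- `HNN(K, H, φ) = ⟨K, t | t h t⁻¹ = φ h (h ∈ H)⟩` for an injective homomorphism `φ : H →* K`. -/
abbrev HNN {K : Type*} [Group K] (H : Subgroup K) (φ : H →* K)
    (hφ : Function.Injective φ) : Type _ :=
  HNNExtension K H φ.range (MonoidHom.ofInjective hφ)

/-- The HNN extension is ascending if `H = K` or `φ(H) = K`. -/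
def IsAscendingHNN {K : Type*} [Group K] (H : Subgroup K) (φ : H →* K) : Prop :=
  H = ⊤ ∨ φ.range = ⊤

/-! ### Finitely additive means and conjugation -/

namespace Mean

variable {X Y : Type*} (m : Mean X)

/-! Part (1) is a paradoxicality argument on normal forms; the rest moves means along injections. In
the amalgam, let `U j` be the elements whose reduced word starts in factor `j`; off `H`, these sets
cover the group. Conjugating by a letter outside `H` sends each `U j` into the other. If factor `i`
has two distinct nontrivial cosets of `H`, two such conjugations carry `U (!i)` into disjoint pieces
of `U i`. Hence `2 m(U (!i)) ≤ m(U i) ≤ m(U (!i))`, and both vanish. In the HNN extension, let `W u`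
be the elements starting with `t ^ u`. Left translates by some `b ∉ φ(H)` and `a ∉ H` give disjoint
copies of `W 1` and `W (-1)`, at least as large, while conjugation by `t` sends everything outside
`H ∪ W (-1)` into `W 1`. So `m(H) + 2w ≤ 1 ≤ m(H) + w`, where `w = m(W 1) + m(W (-1))`; thus `w =
0`. Concentration on `H` lets means restrict to the factors. Conversely, a push-forward is
conjugation invariant because its conjugation stabilizer is a subgroup containing generators. -/

theorem empty : m ∅ = 0 := by
  have h := m.union' ∅ ∅ (Set.disjoint_empty _)
  rw [Set.union_empty] at h
  linarith

theorem mono {E F : Set X} (h : E ⊆ F) : m E ≤ m F := by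
  have h₁ := m.union' E (F \ E) Set.disjoint_sdiff_right
  rw [Set.union_sdiff_cancel h] at h₁
  linarith [m.nonneg' (F \ E)]

theorem le_one (E : Set X) : m E ≤ 1 := m.univ' ▸ m.mono (Set.subset_univ E)

theorem compl (E : Set X) : m Eᶜ = 1 - m E := by
  have h := m.union' E Eᶜ disjoint_compl_right
  rw [Set.union_compl_self, m.univ'] at h
  linarith

theorem union_le (E F : Set X) : m (E ∪ F) ≤ m E + m F := by
  rw [← Set.union_sdiff_self, m.union' _ _ Set.disjoint_sdiff_right]
  linarith [m.mono (Set.sdiff_subset : F \ E ⊆ F)]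

variable {m}

theorem ConcentratesOn.mono {S T : Set X} (hS : m.ConcentratesOn S) (h : S ⊆ T) :
    m.ConcentratesOn T :=
  le_antisymm (m.le_one T) (hS ▸ m.mono h)

theorem ConcentratesOn.inter_eq {S : Set X} (hS : m.ConcentratesOn S) (E : Set X) :
    m (E ∩ S) = m E := by
  have h₁ := m.union' (E ∩ S) (E \ S) Set.disjoint_sdiff_inter.symm
  rw [Set.inter_union_sdiff] at h₁
  have h₂ : m (E \ S) ≤ m Sᶜ := m.mono fun _ hx => hx.2
  rw [m.compl, show m S = 1 from hS] at h₂
  linarith [m.nonneg' (E \ S)]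

variable (m)

/-- The image of a mean under a map. -/
def map (f : X → Y) : Mean Y where
  toFun E := m (f ⁻¹' E)
  nonneg' _ := m.nonneg' _
  univ' := m.univ'
  union' _ _ h := m.union' _ _ (h.preimage f)

/-- The restriction of a mean along an injection on whose range it concentrates. -/
def comap (m : Mean Y) (f : X → Y) (hf : Function.Injective f)
    (hm : m.ConcentratesOn (Set.range f)) : Mean X where
  toFun E := m (f '' E)
  nonneg' _ := m.nonneg' _
  univ' := by rw [Set.image_univ]; exact hm
  union' E F h := by
    rw [Set.image_union]
    exact m.union' _ _ ((Set.disjoint_image_iff hf).2 h)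

theorem map_apply (f : X → Y) (E : Set Y) : m.map f E = m (f ⁻¹' E) := rfl

theorem comap_apply (m : Mean Y) (f : X → Y) (hf : Function.Injective f)
    (hm : m.ConcentratesOn (Set.range f)) (E : Set X) : m.comap f hf hm E = m (f '' E) := rfl

variable {m}

theorem Atomless.comap {m : Mean Y} (h : m.Atomless) (f : X → Y) (hf : Function.Injective f)
    (hm : m.ConcentratesOn (Set.range f)) : (m.comap f hf hm).Atomless := fun x => by
  rw [comap_apply, Set.image_singleton]
  exact h _

theorem Atomless.map (h : m.Atomless) {f : X → Y} (hf : Function.Injective f) :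
    (m.map f).Atomless := fun y => by
  rw [map_apply]
  rcases (Set.subsingleton_singleton.preimage hf).eq_empty_or_singleton with h' | ⟨x, h'⟩
  · rw [h', m.empty]
  · rw [h']
    exact h x

variable {G K : Type*} [Group G] [Group K]

theorem ConjInvariant.comap {m : Mean G} (h : m.ConjInvariant) (f : K →* G)
    (hf : Function.Injective f) (hm : m.ConcentratesOn (Set.range f)) :
    (m.comap f hf hm).ConjInvariant := fun g E => by
  rw [comap_apply, comap_apply, ← h (f g) (f '' E), Set.image_image, Set.image_image]
  simp

theorem ConjInvariant.map_conj {m : Mean K} (h : m.ConjInvariant) (f : K →* G) (k : K)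
    (E : Set G) : m.map f ((fun x => f k * x * (f k)⁻¹) '' E) = m.map f E := by
  rw [map_apply, map_apply, ← h k (f ⁻¹' E)]
  congr 1
  ext x
  constructor
  · rintro ⟨y, hy, hyx⟩
    refine ⟨k⁻¹ * x * k, ?_, by group⟩
    have : f (k⁻¹ * x * k) = y := by
      simp only [map_mul, map_inv, ← hyx]
      group
    rwa [Set.mem_preimage, this]
  · rintro ⟨y, hy, rfl⟩
    exact ⟨f y, hy, by simp⟩

/-- The set of elements under whose conjugation a mean is invariant is a subgroup. -/
def conjStabilizer (m : Mean G) : Subgroup G where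
  carrier := {g | ∀ E : Set G, m ((fun x => g * x * g⁻¹) '' E) = m E}
  one_mem' E := by simp
  mul_mem' {a b} ha hb E := by
    rw [← hb E, ← ha ((fun x => b * x * b⁻¹) '' E), Set.image_image]
    congr 2
    funext x
    group
  inv_mem' {a} ha E := by
    rw [← ha, Set.image_image]
    congr 1
    simp [mul_assoc]

theorem mem_conjStabilizer {m : Mean G} {g : G} :
    g ∈ m.conjStabilizer ↔ ∀ E : Set G, m ((fun x => g * x * g⁻¹) '' E) = m E := Iff.rfl

/-- Supplies the conjugation estimates in both paradoxicality arguments. -/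
theorem ConjInvariant.le_of_conj_mem {m : Mean G} (h : m.ConjInvariant) (g : G) {E F : Set G}
    (hE : ∀ x ∈ E, g * x * g⁻¹ ∈ F) : m E ≤ m F := by
  rw [← h g E]
  exact m.mono (Set.image_subset_iff.2 hE)

end Mean

theorem InnerAmenable.of_concentratesOn {G K : Type*} [Group G] [Group K] {m : Mean G}
    (h : m.ConjInvariant) (h₀ : m.Atomless) (f : K →* G) (hf : Function.Injective f)
    (hm : m.ConcentratesOn (Set.range f)) : InnerAmenable K :=
  ⟨m.comap f hf hm, h.comap f hf hm, h₀.comap f hf hm⟩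

/-! ### First letters of reduced words in amalgams -/

namespace Monoid.PushoutI

variable {ι : Type*} {G : ι → Type*} {H : Type*} [∀ i, Group (G i)] [Group H]
  {φ : ∀ i, H →* G i}

variable (φ) in
/-- `StartsWith φ i x` says that `x` is represented by a reduced word whose first letter lies in
the factor with index `i`. -/
inductive StartsWith : ι → PushoutI φ → Prop
  | letter {i : ι} {g : G i} : g ∉ (φ i).range → StartsWith i (of i g)
  | cons {i j : ι} {g : G i} {y : PushoutI φ} :
      g ∉ (φ i).range → j ≠ i → StartsWith j y → StartsWith i (of i g * y)

namespace StartsWith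

theorem exists_normalWord (d : NormalWord.Transversal φ) {i : ι} {x : PushoutI φ}
    (hx : StartsWith φ i x) :
    ∃ w : NormalWord d, w.prod = x ∧ w.fstIdx = some i := by
  induction hx with
  | @letter i g hg =>
    refine ⟨NormalWord.cons g NormalWord.empty (by simp [CoprodI.Word.fstIdx]) hg, ?_, ?_⟩
    · rw [NormalWord.prod_cons, NormalWord.prod_empty, mul_one]
    · simp [NormalWord.cons, CoprodI.Word.fstIdx, CoprodI.Word.cons]
  | @cons i j g y hg hij _ ih =>
    obtain ⟨w, rfl, hw⟩ := ih
    refine ⟨NormalWord.cons g w (by simpa [hw] using hij) hg, NormalWord.prod_cons .., ?_⟩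
    simp [NormalWord.cons, CoprodI.Word.fstIdx, CoprodI.Word.cons]

/-- Uniqueness of normal forms: the first index is read off the normal word. -/
theorem index_unique (hφ : ∀ i, Function.Injective (φ i)) {i j : ι} {x : PushoutI φ}
    (hi : StartsWith φ i x) (hj : StartsWith φ j x) : i = j := by
  obtain ⟨d⟩ := NormalWord.transversal_nonempty φ hφ
  obtain ⟨w, hw, hwi⟩ := hi.exists_normalWord d
  obtain ⟨w', hw', hwj⟩ := hj.exists_normalWord d
  obtain rfl := NormalWord.prod_injective (hw.trans hw'.symm)
  exact Option.some_injective _ (hwi.symm.trans hwj)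

theorem ne_base (hφ : ∀ i, Function.Injective (φ i)) {i : ι} {x : PushoutI φ}
    (hx : StartsWith φ i x) (h : H) : x ≠ base φ h := by
  rintro rfl
  obtain ⟨d⟩ := NormalWord.transversal_nonempty φ hφ
  obtain ⟨w, hw, hwi⟩ := hx.exists_normalWord d
  have h₁ : w.prod = (h • (NormalWord.empty : NormalWord d)).prod := by simp [hw]
  obtain rfl := NormalWord.prod_injective h₁
  simp [CoprodI.Word.fstIdx, NormalWord.base_smul_def'] at hwi

theorem base_mul {i : ι} {x : PushoutI φ} (hx : StartsWith φ i x) (h : H) :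
    StartsWith φ i (base φ h * x) := by
  have key : ∀ i {g : G i}, g ∉ (φ i).range → φ i h * g ∉ (φ i).range := fun i g hg hgh =>
    hg ((Subgroup.mul_mem_cancel_left _ (MonoidHom.mem_range.2 ⟨h, rfl⟩)).1 hgh)
  cases hx with
  | letter hg =>
    rw [← of_apply_eq_base φ i, ← map_mul]
    exact .letter (key i hg)
  | cons hg hij hy =>
    rw [← of_apply_eq_base φ i, ← mul_assoc, ← map_mul]
    exact .cons (key i hg) hij hy

theorem letter_mul_base {i : ι} {g : G i} (hg : g ∉ (φ i).range) (h : H) :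
    StartsWith φ i (of i g * base φ h) := by
  rw [← of_apply_eq_base φ i, ← map_mul]
  exact .letter fun hgh =>
    hg ((Subgroup.mul_mem_cancel_right _ (MonoidHom.mem_range.2 ⟨h, rfl⟩)).1 hgh)

/-- Right multiplication can disturb the first letter only when everything after it has been
absorbed into the base; a tail collapsing into the base merely modifies that letter. -/
theorem mul_of {i j : ι} {x : PushoutI φ} (hx : StartsWith φ i x) (g : G j) :
    StartsWith φ i (x * of j g) ∨ x * of j g ∈ (base φ).range := by
  induction hx with
  | @letter i a ha =>
    rcases eq_or_ne j i with rfl | hij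
    · rw [← map_mul]
      by_cases hag : a * g ∈ (φ j).range
      · obtain ⟨h, hh⟩ := hag
        exact .inr ⟨h, by rw [← hh, of_apply_eq_base]⟩
      · exact .inl (.letter hag)
    · by_cases hg : g ∈ (φ j).range
      · obtain ⟨h, rfl⟩ := hg
        rw [of_apply_eq_base]
        exact .inl (letter_mul_base ha h)
      · exact .inl (.cons ha hij (.letter hg))
  | @cons i k a y ha hik _ ih =>
    rw [mul_assoc]
    rcases ih with ih | ⟨h, hh⟩
    · exact .inl (.cons ha hik ih)
    · rw [← hh]
      exact .inl (letter_mul_base ha h)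

theorem of_or_base {j : ι} (g : G j) :
    StartsWith φ j (of j g) ∨ of j g ∈ (base φ).range := by
  by_cases hg : g ∈ (φ j).range
  · obtain ⟨h, rfl⟩ := hg
    exact .inr ⟨h, (of_apply_eq_base φ j h).symm⟩
  · exact .inl (.letter hg)

/-- A collapse into the base would put `x` itself in factor `j`, contradicting the uniqueness of its
first index. -/
theorem mul_of_of_ne (hφ : ∀ i, Function.Injective (φ i)) {i j : ι} (hij : i ≠ j)
    {x : PushoutI φ} (hx : StartsWith φ i x) (g : G j) : StartsWith φ i (x * of j g) := by
  refine (hx.mul_of g).resolve_right ?_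
  rintro ⟨h, hh⟩
  have hx' : x = of j (φ j h * g⁻¹) := by
    rw [map_mul, of_apply_eq_base, hh, map_inv, mul_inv_cancel_right]
  rcases of_or_base (φ := φ) (φ j h * g⁻¹) with h₁ | ⟨h', hh'⟩
  · exact hij (hx.index_unique hφ (hx' ▸ h₁))
  · exact hx.ne_base hφ h' (hx'.trans hh'.symm)

theorem of_mul_or_base {j : ι} (g : G j) {x : PushoutI φ}
    (hx : (∃ i, StartsWith φ i x) ∨ x ∈ (base φ).range) :
    (∃ i, StartsWith φ i (of j g * x)) ∨ of j g * x ∈ (base φ).range := by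
  rcases hx with ⟨i, hx⟩ | ⟨h, rfl⟩
  · by_cases hg : g ∈ (φ j).range
    · obtain ⟨h, rfl⟩ := hg
      rw [of_apply_eq_base]
      exact .inl ⟨i, hx.base_mul h⟩
    · rcases ne_or_eq i j with hij | rfl
      · exact .inl ⟨j, .cons hg hij hx⟩
      · cases hx with
        | letter ha =>
          rw [← map_mul]
          exact (of_or_base _).imp_left fun h => ⟨_, h⟩
        | @cons _ k a y ha hik hy =>
          rw [← mul_assoc, ← map_mul]
          by_cases hga : g * a ∈ (φ i).range
          · obtain ⟨h, hh⟩ := hga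
            rw [← hh, of_apply_eq_base]
            exact .inl ⟨k, hy.base_mul h⟩
          · exact .inl ⟨i, .cons hga hik hy⟩
  · rw [← of_apply_eq_base φ j, ← map_mul]
    exact (of_or_base _).imp_left fun h => ⟨_, h⟩

theorem exists_or_mem_base [Nonempty ι] (x : PushoutI φ) :
    (∃ i, StartsWith φ i x) ∨ x ∈ (base φ).range := by
  -- Quantifying over the right factor lets the induction on `x` pass through products.
  have key : ∀ y : PushoutI φ, ((∃ i, StartsWith φ i y) ∨ y ∈ (base φ).range) →
      ((∃ i, StartsWith φ i (x * y)) ∨ x * y ∈ (base φ).range) := by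
    induction x using PushoutI.induction_on with
    | of i g => exact fun y hy => of_mul_or_base g hy
    | base h =>
      rw [← of_apply_eq_base φ (Classical.arbitrary ι)]
      exact fun y hy => of_mul_or_base _ hy
    | mul a b ha hb =>
      intro y hy
      rw [mul_assoc]
      exact ha _ (hb _ hy)
  simpa using key 1 (.inr (one_mem _))

/-- Conjugating by a letter `g` outside the base turns elements starting in another factor into
elements whose first letter is `g`. -/
theorem exists_conj_eq (hφ : ∀ i, Function.Injective (φ i)) {i j : ι} (hij : i ≠ j)
    {x : PushoutI φ} (hx : StartsWith φ i x) (g : G j) :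
    ∃ y, StartsWith φ i y ∧ of j g * y = of j g * x * (of j g)⁻¹ :=
  ⟨x * of j g⁻¹, hx.mul_of_of_ne hφ hij _, by rw [map_inv, mul_assoc]⟩

end StartsWith

open StartsWith in
theorem concentratesOn_base {G : Bool → Type*} [∀ i, Group (G i)] {φ : ∀ i, H →* G i}
    (hφ : ∀ i, Function.Injective (φ i)) (hne : ∀ i, (φ i).range ≠ ⊤) {i : Bool} {a b : G i}
    (ha : a ∉ (φ i).range) (hb : b ∉ (φ i).range) (hab : a⁻¹ * b ∉ (φ i).range)
    {m : Mean (PushoutI φ)} (hm : m.ConjInvariant) :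
    m.ConcentratesOn (Set.range (base φ)) := by
  have hi : (!i) ≠ i := by simp
  obtain ⟨c, hc⟩ : ∃ c, c ∉ (φ (!i)).range := by
    by_contra! h
    exact hne _ ((Subgroup.eq_top_iff' _).2 h)
  let U : Bool → Set (PushoutI φ) := fun j => {x | StartsWith φ j x}
  let V : G i → Set (PushoutI φ) := fun g => (fun x => of i g * x) '' U (!i)
  have hVU : ∀ g ∉ (φ i).range, V g ⊆ U i := by
    rintro g hg _ ⟨y, hy, rfl⟩
    exact .cons hg hi hy
  have hUV : ∀ g, m (U (!i)) ≤ m (V g) := fun g => by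
    refine hm.le_of_conj_mem (of i g) fun x hx => ?_
    exact exists_conj_eq hφ hi hx g
  have hdisj : Disjoint (V a) (V b) := by
    rw [Set.disjoint_left]
    rintro _ ⟨y, hy, rfl⟩ ⟨z, hz, hzy⟩
    -- A common point would make `y` start in both factors, since `a` and `b` lie in different
    -- cosets.
    have h₁ : y = of i (a⁻¹ * b) * z := by
      rw [map_mul, mul_assoc, show of i b * z = of i a * y from hzy, map_inv,
        inv_mul_cancel_left]
    exact hi (index_unique hφ (h₁ ▸ hy) (.cons hab hi hz))
  have h₁ : m (U i) ≤ m (U (!i)) := by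
    refine hm.le_of_conj_mem (of (!i) c) fun x hx => ?_
    obtain ⟨y, hy, hyx⟩ := exists_conj_eq hφ hi.symm hx c
    rw [← hyx]
    exact .cons hc hi.symm hy
  have h₂ : m (V a) + m (V b) ≤ m (U i) := by
    rw [← m.union' _ _ hdisj]
    exact m.mono (Set.union_subset (hVU a ha) (hVU b hb))
  have h₃ : m (Set.range (base φ))ᶜ ≤ m (U i ∪ U (!i)) := by
    refine m.mono fun x hx => ?_
    obtain ⟨j, hj⟩ := (exists_or_mem_base x).resolve_right hx
    rcases Bool.eq_or_eq_not j i with rfl | rfl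
    · exact .inl hj
    · exact .inr hj
  rw [m.compl] at h₃
  refine le_antisymm (m.le_one _) ?_
  -- The bounds `2 m(U (!i)) ≤ m(U i) ≤ m(U (!i))` force both measures to be zero.
  linarith [m.union_le (U i) (U (!i)), hUV a, hUV b, m.nonneg' (U i), m.nonneg' (U (!i))]

end Monoid.PushoutI

theorem Subgroup.exists_notMem_of_three_le_card {G : Type*} [Group G] {H : Subgroup G}
    (h : 3 ≤ ENat.card (G ⧸ H)) : ∃ a b : G, a ∉ H ∧ b ∉ H ∧ a⁻¹ * b ∉ H := by
  have h₁ : 1 < ({((1 : G) : G ⧸ H)}ᶜ : Set (G ⧸ H)).encard := by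
    by_contra! h₁
    have h₂ := Set.encard_add_encard_compl ({((1 : G) : G ⧸ H)} : Set (G ⧸ H))
    rw [Set.encard_singleton, Set.encard_univ] at h₂
    have h₃ : (3 : ℕ∞) ≤ 1 + 1 := h.trans (h₂ ▸ by gcongr)
    revert h₃
    decide
  obtain ⟨a, b, ha, hb, hab⟩ := Set.one_lt_encard_iff.1 h₁
  induction a using QuotientGroup.induction_on with | H a
  induction b using QuotientGroup.induction_on with | H b
  refine ⟨a, b, fun h => ha ?_, fun h => hb ?_, fun h => hab (QuotientGroup.eq.2 h)⟩
  · exact (QuotientGroup.eq.2 (by simpa using h)).symm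
  · exact (QuotientGroup.eq.2 (by simpa using h)).symm

/-! ### Transfer of means between an amalgam and its factors -/

section Amalgam

open Monoid.PushoutI

variable {A B : Type u} {H : Type v} [Group A] [Group B] [Group H] {iA : H →* A} {iB : H →* B}

theorem Amalgam.incl_injective (hA : Function.Injective iA) (hB : Function.Injective iB) :
    ∀ b, Function.Injective (Amalgam.incl iA iB b)
  | false => hA
  | true => hB

theorem NondegenerateAmalgam.concentratesOn_base (hA : Function.Injective iA)
    (hB : Function.Injective iB) (h : NondegenerateAmalgam iA iB)
    {m : Mean (AmalgamatedProduct iA iB)} (hm : m.ConjInvariant) :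
    m.ConcentratesOn (Set.range (base (Amalgam.incl iA iB))) := by
  have hne : ∀ b, (Amalgam.incl iA iB b).range ≠ ⊤
    | false => h.1
    | true => h.2.1
  rcases h.2.2 with hc | hc
  · obtain ⟨a, b, ha, hb, hab⟩ := Subgroup.exists_notMem_of_three_le_card hc
    exact Monoid.PushoutI.concentratesOn_base (Amalgam.incl_injective hA hB) hne
      (i := false) ha hb hab hm
  · obtain ⟨a, b, ha, hb, hab⟩ := Subgroup.exists_notMem_of_three_le_card hc
    exact Monoid.PushoutI.concentratesOn_base (Amalgam.incl_injective hA hB) hne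
      (i := true) ha hb hab hm

variable (iA iB) in
/-- The canonical map `A →* A *_H B`. -/
def AmalgamatedProduct.inl : A →* AmalgamatedProduct iA iB :=
  of (φ := Amalgam.incl iA iB) false

variable (iA iB) in
/-- The canonical map `B →* A *_H B`. -/
def AmalgamatedProduct.inr : B →* AmalgamatedProduct iA iB :=
  of (φ := Amalgam.incl iA iB) true

namespace AmalgamatedProduct

theorem inl_apply (h : H) : inl iA iB (iA h) = base (Amalgam.incl iA iB) h :=
  of_apply_eq_base (Amalgam.incl iA iB) false h

theorem inr_apply (h : H) : inr iA iB (iB h) = base (Amalgam.incl iA iB) h :=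
  of_apply_eq_base (Amalgam.incl iA iB) true h

theorem inl_injective (hA : Function.Injective iA) (hB : Function.Injective iB) :
    Function.Injective (inl iA iB) :=
  of_injective (Amalgam.incl_injective hA hB) false

theorem inr_injective (hA : Function.Injective iA) (hB : Function.Injective iB) :
    Function.Injective (inr iA iB) :=
  of_injective (Amalgam.incl_injective hA hB) true

theorem range_base_subset_inl :
    Set.range (base (Amalgam.incl iA iB)) ⊆ Set.range (inl iA iB) := by
  rintro _ ⟨h, rfl⟩
  exact ⟨iA h, inl_apply h⟩

theorem range_base_subset_inr :
    Set.range (base (Amalgam.incl iA iB)) ⊆ Set.range (inr iA iB) := by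
  rintro _ ⟨h, rfl⟩
  exact ⟨iB h, inr_apply h⟩

theorem inl_image (E : Set H) : inl iA iB '' (iA '' E) = base (Amalgam.incl iA iB) '' E := by
  simp only [Set.image_image, inl_apply]

theorem inr_image (E : Set H) : inr iA iB '' (iB '' E) = base (Amalgam.incl iA iB) '' E := by
  simp only [Set.image_image, inr_apply]

/-- Both push-forwards live on the common image of `H`, where the two means agree. -/
theorem map_inl_eq_map_inr {mA : Mean A} {mB : Mean B} (hmA : mA.ConcentratesOn (Set.range iA))
    (hmB : mB.ConcentratesOn (Set.range iB)) (h : ∀ E : Set H, mA (iA '' E) = mB (iB '' E))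
    (E : Set (AmalgamatedProduct iA iB)) :
    mA.map (inl iA iB) E = mB.map (inr iA iB) E := by
  rw [Mean.map_apply, Mean.map_apply, ← hmA.inter_eq, ← hmB.inter_eq,
    ← Set.image_preimage_eq_inter_range, ← Set.image_preimage_eq_inter_range, h]
  congr 2
  ext x
  simp only [Set.mem_preimage, inl_apply, inr_apply]

/-- Invariance under `A` is inherited from `mA`; invariance under `B` follows by viewing the same
mean as the push-forward of `mB`. -/
theorem conjInvariant_map {mA : Mean A} {mB : Mean B} (hA : mA.ConjInvariant)
    (hB : mB.ConjInvariant) (hmA : mA.ConcentratesOn (Set.range iA))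
    (hmB : mB.ConcentratesOn (Set.range iB)) (h : ∀ E : Set H, mA (iA '' E) = mB (iB '' E)) :
    (mA.map (inl iA iB)).ConjInvariant := by
  have hl : ∀ a, inl iA iB a ∈ (mA.map (inl iA iB)).conjStabilizer := fun a E =>
    hA.map_conj (inl iA iB) a E
  have hr : ∀ b, inr iA iB b ∈ (mA.map (inl iA iB)).conjStabilizer := fun b E => by
    rw [map_inl_eq_map_inr hmA hmB h, map_inl_eq_map_inr hmA hmB h]
    exact hB.map_conj (inr iA iB) b E
  intro g
  refine Mean.mem_conjStabilizer.1 ?_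
  induction g using Monoid.PushoutI.induction_on with
  | of i g =>
    cases i
    · exact hl g
    · exact hr g
  | base h => exact inl_apply (iA := iA) (iB := iB) h ▸ hl (iA h)
  | mul x y hx hy => exact mul_mem hx hy

end AmalgamatedProduct

end Amalgam

/-! ### Leading stable letters in HNN extensions -/

namespace HNNExtension

variable {G : Type*} [Group G] {A B : Subgroup G} {φ : A ≃* B}

/-- `StartsWith φ u x` says that `x` is represented by a reduced word which begins with `t ^ u`. -/
inductive StartsWith (φ : A ≃* B) : ℤˣ → HNNExtension G A B φ → Prop
  | letter (u : ℤˣ) (g : G) : StartsWith φ u (t ^ (u : ℤ) * of g)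
  | cons {u v : ℤˣ} {g : G} {y : HNNExtension G A B φ} :
      (g ∈ toSubgroup A B u → u = v) → StartsWith φ v y →
        StartsWith φ u (t ^ (u : ℤ) * of g * y)

theorem exists_of_mul_t_zpow (u : ℤˣ) {b : G} (hb : b ∈ toSubgroup A B (-u)) :
    ∃ a ∈ toSubgroup A B u,
      (of b * t ^ (u : ℤ) : HNNExtension G A B φ) = t ^ (u : ℤ) * of a := by
  rcases Int.units_eq_one_or u with rfl | rfl
  · exact ⟨φ.symm ⟨b, hb⟩, SetLike.coe_mem _, by simpa using of_mul_t (φ := φ) ⟨b, hb⟩⟩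
  · exact ⟨φ ⟨b, hb⟩, SetLike.coe_mem _, by simpa using of_mul_inv_t (φ := φ) ⟨b, hb⟩⟩

theorem exists_t_zpow_mul_of (u : ℤˣ) {a : G} (ha : a ∈ toSubgroup A B u) :
    ∃ b ∈ toSubgroup A B (-u),
      (t ^ (u : ℤ) * of a : HNNExtension G A B φ) = of b * t ^ (u : ℤ) := by
  rcases Int.units_eq_one_or u with rfl | rfl
  · exact ⟨φ ⟨a, ha⟩, SetLike.coe_mem _, by simpa using t_mul_of (φ := φ) ⟨a, ha⟩⟩
  · exact ⟨φ.symm ⟨a, ha⟩, SetLike.coe_mem _, by simpa using inv_t_mul_of (φ := φ) ⟨a, ha⟩⟩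

namespace StartsWith

open NormalWord

theorem exists_reducedWord {u : ℤˣ} {x : HNNExtension G A B φ} (hx : StartsWith φ u x) :
    ∃ w : ReducedWord G A B, w.head = 1 ∧ w.prod φ = x ∧
      w.toList.head?.map Prod.fst = some u := by
  induction hx with
  | letter u g => exact ⟨⟨1, [(u, g)], by simp⟩, rfl, by simp [ReducedWord.prod], rfl⟩
  | @cons u v g y hg _ ih =>
    obtain ⟨w, hw, rfl, hv⟩ := ih
    refine ⟨⟨1, (u, g) :: w.toList, List.isChain_cons.2 ⟨fun p hp hgu => ?_, w.chain⟩⟩, rfl, ?_,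
      rfl⟩
    · rw [Option.mem_def.1 hp] at hv
      exact (hg hgu).trans (Option.some_injective _ hv).symm
    · simp [ReducedWord.prod, hw]

/-- Britton's lemma in uniqueness form: reduced words with equal products have the same exponents,
and their heads agree modulo the subgroup that slides past the first stable letter. -/
theorem eq_and_mem {u v : ℤˣ} {x y : HNNExtension G A B φ} (hx : StartsWith φ u x)
    (hy : StartsWith φ v y) {g : G} (h : of g * x = y) : u = v ∧ g ∈ toSubgroup A B (-u) := by
  obtain ⟨w, hw, rfl, hu⟩ := hx.exists_reducedWord
  obtain ⟨w', hw', rfl, hv⟩ := hy.exists_reducedWord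
  have h₁ : (⟨g, w.toList, w.chain⟩ : ReducedWord G A B).prod φ = w'.prod φ := by
    rw [← h]
    simp [ReducedWord.prod, hw]
  obtain ⟨h₂, h₃⟩ := ReducedWord.map_fst_eq_and_of_prod_eq φ h₁
  constructor
  · have h₄ := congrArg List.head? h₂
    rw [List.head?_map, List.head?_map, hv] at h₄
    exact Option.some_injective _ (hu.symm.trans h₄)
  · simpa [hw'] using h₃ u hu

theorem ne_of {u : ℤˣ} {x : HNNExtension G A B φ} (hx : StartsWith φ u x) (g : G) :
    x ≠ of g := by
  rintro rfl
  obtain ⟨w, -, hw, hu⟩ := hx.exists_reducedWord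
  simp [ReducedWord.toList_eq_nil_of_mem_of_range φ w ⟨g, hw.symm⟩] at hu

theorem of_mul {u : ℤˣ} {x : HNNExtension G A B φ} (hx : StartsWith φ u x) {b : G}
    (hb : b ∈ toSubgroup A B (-u)) : StartsWith φ u (of b * x) := by
  obtain ⟨a, ha, hab⟩ := exists_of_mul_t_zpow (φ := φ) u hb
  cases hx with
  | letter _ g =>
    rw [← mul_assoc, hab, mul_assoc, ← map_mul]
    exact .letter _ _
  | @cons _ v g y hg hy =>
    rw [← mul_assoc, ← mul_assoc, hab, mul_assoc (t ^ (u : ℤ)), ← map_mul]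
    exact .cons (fun h => hg ((Subgroup.mul_mem_cancel_left _ ha).1 h)) hy

theorem mul_of {u : ℤˣ} {x : HNNExtension G A B φ} (hx : StartsWith φ u x) (g : G) :
    StartsWith φ u (x * of g) := by
  induction hx with
  | letter u a =>
    rw [mul_assoc, ← map_mul]
    exact .letter _ _
  | cons ha _ ih =>
    rw [mul_assoc]
    exact .cons ha ih

/-- The first stable letter disappears only through a pinch `t ^ u * a * t ^ (-u)`, which lands in
the associated subgroup. -/
theorem mul_t_zpow {u : ℤˣ} {x : HNNExtension G A B φ} (hx : StartsWith φ u x) (v : ℤˣ) :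
    StartsWith φ u (x * t ^ (v : ℤ)) ∨ ∃ b ∈ toSubgroup A B (-u), x * t ^ (v : ℤ) = of b := by
  induction hx with
  | letter u a =>
    by_cases ha : a ∈ toSubgroup A B u → u = v
    · refine .inl ?_
      simpa using StartsWith.cons ha (.letter (φ := φ) v 1)
    · push Not at ha
      obtain rfl : v = -u := Int.units_ne_iff_eq_neg.1 ha.2.symm
      obtain ⟨b, hb, hab⟩ := exists_t_zpow_mul_of (φ := φ) u ha.1
      exact .inr ⟨b, hb, by rw [hab]; simp⟩
  | cons ha _ ih =>
    rw [mul_assoc]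
    rcases ih with ih | ⟨b, -, hb⟩
    · exact .inl (.cons ha ih)
    · rw [hb, mul_assoc, ← map_mul]
      exact .inl (.letter _ _)

theorem of_isChain (p : ℤˣ × G) (l : List (ℤˣ × G))
    (hl : (p :: l).IsChain fun a b => a.2 ∈ toSubgroup A B a.1 → a.1 = b.1) :
    StartsWith φ p.1 ((p :: l).map fun x => t ^ (x.1 : ℤ) * of x.2).prod := by
  induction l generalizing p with
  | nil =>
    simp only [List.map_cons, List.map_nil, List.prod_cons, List.prod_nil, mul_one]
    exact .letter _ _
  | cons q l ih =>
    rw [List.map_cons, List.prod_cons]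
    exact .cons (List.isChain_cons_cons.1 hl).1 (ih q (List.isChain_cons_cons.1 hl).2)

theorem eq_of_or_exists (x : HNNExtension G A B φ) :
    (∃ g, x = of g) ∨ ∃ g u y, StartsWith φ u y ∧ x = of g * y := by
  obtain ⟨d⟩ := TransversalPair.nonempty G A B
  obtain ⟨⟨⟨g, l, hl⟩, -⟩, rfl⟩ := (NormalWord.equiv φ d).symm.surjective x
  change (∃ g', ReducedWord.prod φ ⟨g, l, hl⟩ = of g') ∨
    ∃ g' u y, StartsWith φ u y ∧ ReducedWord.prod φ ⟨g, l, hl⟩ = of g' * y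
  cases l with
  | nil => exact .inl ⟨g, by simp [ReducedWord.prod]⟩
  | cons p l => exact .inr ⟨g, p.1, _, of_isChain p l hl, rfl⟩

/-- A new letter `t ^ u` can only cancel against a leading `t ^ (-u)`; the element of `K` between
them must then slide through, so `x` would already start with `t ^ (-u)`. -/
theorem t_zpow_mul {u : ℤˣ} {x : HNNExtension G A B φ} (hx : ¬ StartsWith φ (-u) x) :
    StartsWith φ u (t ^ (u : ℤ) * x) := by
  rcases eq_of_or_exists x with ⟨g, rfl⟩ | ⟨g, v, y, hy, rfl⟩
  · exact .letter _ _
  · rw [← mul_assoc]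
    refine .cons (fun hg => ?_) hy
    by_contra huv
    obtain rfl : v = -u := Int.units_ne_iff_eq_neg.1 (Ne.symm huv)
    exact hx (hy.of_mul (by rwa [neg_neg]))

/-- If `x * t⁻¹` started with `t⁻¹`, multiplying back by `t` would make `x` start with `t⁻¹` or lie
in `A`. So the `t` on the left survives. -/
theorem conj_t {x : HNNExtension G A B φ} (hx : ¬ StartsWith φ (-1) x)
    (hxA : ∀ a ∈ A, x ≠ of a) : StartsWith φ 1 (t * x * t⁻¹) := by
  have h : ¬ StartsWith φ (-1) (x * t⁻¹) := fun h => by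
    rcases h.mul_t_zpow 1 with h | ⟨a, ha, h⟩
    · exact hx (by simpa using h)
    · exact hxA a ha (by simpa using h)
  simpa [mul_assoc] using t_zpow_mul (u := 1) h

theorem not_mul_of_notMem {u v : ℤˣ} {x : HNNExtension G A B φ} (hx : StartsWith φ u x) {g : G}
    (hg : g ∉ toSubgroup A B (-u)) : ¬ StartsWith φ v (of g * x) := fun h =>
  hg (hx.eq_and_mem h rfl).2

end StartsWith

open StartsWith in
theorem concentratesOn_of_image (hA : A ≠ ⊤) (hB : B ≠ ⊤) {m : Mean (HNNExtension G A B φ)}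
    (hm : m.ConjInvariant) : m.ConcentratesOn (of '' (A : Set G)) := by
  obtain ⟨a, ha⟩ : ∃ a, a ∉ A := by
    by_contra! h
    exact hA ((Subgroup.eq_top_iff' _).2 h)
  obtain ⟨b, hb⟩ : ∃ b, b ∉ B := by
    by_contra! h
    exact hB ((Subgroup.eq_top_iff' _).2 h)
  let W : ℤˣ → Set (HNNExtension G A B φ) := fun u => {x | StartsWith φ u x}
  let T : G → ℤˣ → Set (HNNExtension G A B φ) := fun g u => (fun x => of g * x) '' W u
  have hT : ∀ g u, m (W u) ≤ m (T g u) := fun g u => by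
    refine hm.le_of_conj_mem (of g) fun x hx => ⟨x * of g⁻¹, hx.mul_of _, ?_⟩
    simp [mul_assoc]
  have hWW : Disjoint (W 1) (W (-1)) := by
    rw [Set.disjoint_left]
    intro x hx hx'
    exact absurd (hx.eq_and_mem hx' (g := 1) (by simp)).1 (by decide)
  have hTT : Disjoint (T b 1) (T a (-1)) := by
    rw [Set.disjoint_left]
    rintro _ ⟨x, hx, rfl⟩ ⟨y, hy, hyx⟩
    refine absurd (hy.eq_and_mem hx (g := b⁻¹ * a) ?_).1 (by decide)
    rw [map_mul, mul_assoc, show of a * y = of b * x from hyx, map_inv, inv_mul_cancel_left]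
  have hWT : Disjoint (W 1 ∪ W (-1)) (T b 1 ∪ T a (-1)) := by
    rw [Set.disjoint_right]
    rintro _ (⟨x, hx, rfl⟩ | ⟨x, hx, rfl⟩)
    · rintro (h | h) <;> exact hx.not_mul_of_notMem hb h
    · rintro (h | h) <;> exact hx.not_mul_of_notMem ha h
  have hK : Disjoint (of '' (A : Set G)) ((W 1 ∪ W (-1)) ∪ (T b 1 ∪ T a (-1))) := by
    rw [Set.disjoint_left]
    have key : ∀ g (c : G) u y, StartsWith φ u y → of g * y ≠ of c := fun g c u y hy h =>
      hy.ne_of (g⁻¹ * c) (by rw [map_mul, ← h, map_inv, inv_mul_cancel_left])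
    rintro _ ⟨c, -, rfl⟩ ((h | h) | (⟨y, hy, h⟩ | ⟨y, hy, h⟩))
    · exact h.ne_of c rfl
    · exact h.ne_of c rfl
    · exact key _ _ _ _ hy h
    · exact key _ _ _ _ hy h
  -- Only `A` is removed, not the whole base group: an element of the base outside `A` forms no
  -- pinch under conjugation by `t`.
  have h₁ : m (of '' (A : Set G) ∪ W (-1))ᶜ ≤ m (W 1) := by
    refine hm.le_of_conj_mem t fun x hx => conj_t (fun h => hx (.inr h)) ?_
    rintro c hc rfl
    exact hx (.inl ⟨c, hc, rfl⟩)
  have h₂ := m.le_one (of '' (A : Set G) ∪ ((W 1 ∪ W (-1)) ∪ (T b 1 ∪ T a (-1))))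
  rw [m.union' _ _ hK, m.union' _ _ hWT, m.union' _ _ hWW, m.union' _ _ hTT] at h₂
  rw [m.compl] at h₁
  refine le_antisymm (m.le_one _) ?_
  -- With `w = m(W 1) + m(W (-1))`, disjointness gives `m(A) + 2w ≤ 1` and `h₁` gives `1 ≤ m(A) +
  -- w`.
  linarith [m.union_le (of '' (A : Set G)) (W (-1)), hT b 1, hT a (-1), m.nonneg' (W 1),
    m.nonneg' (W (-1))]

end HNNExtension

/-! ### Transfer of means between an HNN extension and its base -/

namespace HNN

variable {K : Type w} [Group K] {H : Subgroup K} {φ : H →* K} {hφ : Function.Injective φ}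

open HNNExtension

theorem of_apply_eq_conj (h : H) :
    (of (φ h) : HNN H φ hφ) = t * of (h : K) * t⁻¹ :=
  equiv_eq_conj (φ := MonoidHom.ofInjective hφ) h

theorem conj_image (E : Set H) :
    (fun x => t * x * t⁻¹) '' ((of : K →* HNN H φ hφ) '' (Subtype.val '' E)) =
      of '' (φ '' E) := by
  simp only [Set.image_image, of_apply_eq_conj]

/-- The mean lives on both `H` and `φ(H)`, and conjugation by `t` carries the first to the second by
`φ`, so the compatibility condition is exactly invariance under `t`. -/
theorem map_of_conj_t {m : Mean K} (hm : m.ConcentratesOn (H : Set K))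
    (h : ∀ E : Set H, m (Subtype.val '' E) = m (φ '' E)) (E : Set (HNN H φ hφ)) :
    m.map of ((fun x => t * x * t⁻¹) '' E) = m.map of E := by
  have hm₁ : m.ConcentratesOn (Set.range (Subtype.val : H → K)) := by simpa using hm
  have hm₂ : m.ConcentratesOn (Set.range φ) := by
    rw [Mean.ConcentratesOn, ← Set.image_univ, ← h, Set.image_univ]
    exact hm₁
  rw [Mean.map_apply, Mean.map_apply, ← hm₂.inter_eq, ← hm₁.inter_eq (of ⁻¹' E),
    ← Set.image_preimage_eq_inter_range, ← Set.image_preimage_eq_inter_range, h]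
  congr 2
  ext x
  simp only [Set.mem_preimage, of_apply_eq_conj]
  constructor
  · rintro ⟨y, hy, hyx⟩
    have : y = of (x : K) := by simpa using hyx
    rwa [← this]
  · exact fun hx => ⟨_, hx, rfl⟩

theorem conjInvariant_map {m : Mean K} (hc : m.ConjInvariant) (hm : m.ConcentratesOn (H : Set K))
    (h : ∀ E : Set H, m (Subtype.val '' E) = m (φ '' E)) :
    (m.map (of : K →* HNN H φ hφ)).ConjInvariant := by
  intro g
  refine Mean.mem_conjStabilizer.1 ?_
  induction g using HNNExtension.induction_on with
  | of g => exact hc.map_conj of g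
  | t => exact map_of_conj_t hm h
  | mul x y hx hy => exact mul_mem hx hy
  | inv x hx => exact inv_mem hx

end HNN

/-! ### Assembly of both cases -/

theorem mainTheorem3 :
    (∀ (A B : Type u) (H : Type v) [Group A] [Group B] [Group H]
        (iA : H →* A) (iB : H →* B),
        Function.Injective iA → Function.Injective iB → NondegenerateAmalgam iA iB →
      (∀ m : Mean (AmalgamatedProduct iA iB), m.ConjInvariant →
        m.ConcentratesOn (Set.range (Monoid.PushoutI.base (Amalgam.incl iA iB)))) ∧
      (InnerAmenable (AmalgamatedProduct iA iB) ↔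
        ∃ (mA : Mean A) (mB : Mean B),
          mA.ConjInvariant ∧ mA.Atomless ∧ mB.ConjInvariant ∧ mB.Atomless ∧
          mA.ConcentratesOn (Set.range iA) ∧ mB.ConcentratesOn (Set.range iB) ∧
          ∀ E : Set H, mA (iA '' E) = mB (iB '' E)) ∧
      (InnerAmenable (AmalgamatedProduct iA iB) →
        InnerAmenable A ∧ InnerAmenable B ∧ InnerAmenable H)) ∧
    (∀ (K : Type w) [Group K] (H : Subgroup K) (φ : H →* K) (hφ : Function.Injective φ),
        ¬ IsAscendingHNN H φ →
      (∀ m : Mean (HNN H φ hφ), m.ConjInvariant →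
        m.ConcentratesOn ((HNNExtension.of : K →* HNN H φ hφ) '' (H : Set K))) ∧
      (InnerAmenable (HNN H φ hφ) ↔
        ∃ m : Mean K,
          m.ConjInvariant ∧ m.Atomless ∧ m.ConcentratesOn (H : Set K) ∧
          ∀ E : Set H, m (Subtype.val '' E) = m (φ '' E)) ∧
      (InnerAmenable (HNN H φ hφ) → InnerAmenable K ∧ InnerAmenable H)) := by
  refine ⟨fun A B H _ _ _ iA iB hA hB hnd => ?_, fun K _ H φ hφ hna => ?_⟩
  · have hconc {m : Mean (AmalgamatedProduct iA iB)} (hm : m.ConjInvariant) :=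
      hnd.concentratesOn_base hA hB hm
    have hl := AmalgamatedProduct.inl_injective hA hB
    have hr := AmalgamatedProduct.inr_injective hA hB
    refine ⟨fun m hm => hconc hm, ⟨?_, ?_⟩, ?_⟩
    · rintro ⟨m, hm, hm₀⟩
      have hml := (hconc hm).mono AmalgamatedProduct.range_base_subset_inl
      have hmr := (hconc hm).mono AmalgamatedProduct.range_base_subset_inr
      refine ⟨m.comap _ hl hml, m.comap _ hr hmr, hm.comap _ hl hml, hm₀.comap _ hl hml,
        hm.comap _ hr hmr, hm₀.comap _ hr hmr, ?_, ?_, fun E => ?_⟩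
      · rw [Mean.ConcentratesOn, Mean.comap_apply, ← Set.image_univ,
          AmalgamatedProduct.inl_image, Set.image_univ]
        exact hconc hm
      · rw [Mean.ConcentratesOn, Mean.comap_apply, ← Set.image_univ,
          AmalgamatedProduct.inr_image, Set.image_univ]
        exact hconc hm
      · rw [Mean.comap_apply, Mean.comap_apply, AmalgamatedProduct.inl_image,
          AmalgamatedProduct.inr_image]
    · rintro ⟨mA, mB, hmA, hmA₀, hmB, -, hcA, hcB, h⟩
      exact ⟨_, AmalgamatedProduct.conjInvariant_map hmA hmB hcA hcB h, hmA₀.map hl⟩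
    · rintro ⟨m, hm, hm₀⟩
      exact ⟨.of_concentratesOn hm hm₀ _ hl
          ((hconc hm).mono AmalgamatedProduct.range_base_subset_inl),
        .of_concentratesOn hm hm₀ _ hr
          ((hconc hm).mono AmalgamatedProduct.range_base_subset_inr),
        .of_concentratesOn hm hm₀ _
          (Monoid.PushoutI.base_injective (Amalgam.incl_injective hA hB)) (hconc hm)⟩
  · obtain ⟨hH, hφH⟩ := not_or.1 hna
    have hconc {m : Mean (HNN H φ hφ)} (hm : m.ConjInvariant) :=
      HNNExtension.concentratesOn_of_image hH hφH hm
    have hinj : Function.Injective (HNNExtension.of : K →* HNN H φ hφ) :=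
      HNNExtension.of_injective _
    refine ⟨fun m hm => hconc hm, ⟨?_, ?_⟩, ?_⟩
    · rintro ⟨m, hm, hm₀⟩
      have hmK := (hconc hm).mono (Set.image_subset_range _ _)
      refine ⟨m.comap _ hinj hmK, hm.comap _ hinj hmK, hm₀.comap _ hinj hmK, hconc hm,
        fun E => ?_⟩
      -- Inside the extension, `φ(E)` is the conjugate of `E` by `t`.
      rw [Mean.comap_apply, Mean.comap_apply, ← HNN.conj_image, hm]
    · rintro ⟨m, hm, hm₀, hmH, h⟩
      exact ⟨_, HNN.conjInvariant_map hm hmH h, hm₀.map hinj⟩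
    · rintro ⟨m, hm, hm₀⟩
      refine ⟨.of_concentratesOn hm hm₀ _ hinj ((hconc hm).mono (Set.image_subset_range _ _)),
        .of_concentratesOn hm hm₀ (HNNExtension.of.comp H.subtype)
          (hinj.comp H.subtype_injective) ((hconc hm).mono ?_)⟩
      rintro _ ⟨x, hx, rfl⟩
      exact ⟨⟨x, hx⟩, rfl⟩
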